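/- Let $N\ge 1$, $\alpha\in(0,1)$, $T>0$, and let $(\Omega,\mathcal F,\mathbb P)$ be a complete probability space carrying independent Brownian motions $\beta^1,\dots,\beta^N$ and a strictly $\alpha$-stable subordinator $L$ independent of them, i.e. $L$ is an increasing Lévy process with $$\mathbb E\left[e^{iuL_1}\right]=\exp\left\{-\bar\gamma^\alpha|u|^\alpha\left(1-i\tan\tfrac{\pi\alpha}{2}\,\mathrm{sign}\,u\right)\right\},\quad u\in\mathbb R,\text{ for some }\bar\gamma>0.$$ Write $W=(\beta^1,\dots,\beta^N)^\top$ and endow $\Omega$ with the minimal augmented filtration generated by $W_L=(W_{L_t})_{t\ge0}$. Let $A=-\mathrm{diag}[\lambda_1,\dots,\lambda_N]$ and $Q=\mathrm{diag}[\sigma_1^2,\dots,\sigma_N^2]$ with $\lambda_i>0$, $\sigma_i>0$. Let $n\ge2$ be an integer. Let $B_0\in C_b^{0,n}([0,T]\times\mathbb R^N;\mathbb R^N)$: $B_0$ is continuous, $B_0(t,\cdot)$ is $n$ times continuously differentiable for every $t\in[0,T]$, and $B_0$ and its partial derivatives in $x$ up to order $n$ are bounded on $[0,T]\times\mathbb R^N$.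 For $0\le s\le T$ and $x\in\mathbb R^N$ let $X^{s,x}=(X^{s,x}_t)_{t\in[s,T]}$ be the adapted càdlàg solution (unique up to indistinguishability) of $$dX^{s,x}_t=\left(AX^{s,x}_t+B_0(t,X^{s,x}_t)\right)dt+\sqrt Q\,dW_{L_t},\qquad X^{s,x}_s=x,$$ and put $P_{s,t}\phi(x)=\mathbb E[\phi(X^{s,x}_t)]$ for $0\le s\le t\le T$ and $\phi:\mathbb R^N\to\mathbb R$ bounded and Borel. Let $C_b^n(\mathbb R^N)$ be the space of bounded, $n$ times continuously differentiable functions $\mathbb R^N\to\mathbb R$ whose partial derivatives up to order $n$ are bounded, and let $\|\partial^i\psi\|_\infty$ be the maximum of the supremum norms of the partial derivatives of $\psi$ of order $i$. If $\phi\in C_b^n(\mathbb R^N)$, then $P_{s,t}\phi\in C_b^n(\mathbb R^N)$ for all $0\le s\le t\le T$, and $$\sup_{0\le s\le t\le T}\left(\|P_{s,t}\phi\|_\infty+\sum_{i=1}^n\|\partial^iP_{s,t}\phi\|_\infty\right)<\infty.$$ -/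

import Mathlib

open MeasureTheory ProbabilityTheory Set Filter Topology
open scoped NNReal ENNReal

/-! ### Spaces of bounded differentiable functions -/

/-- `C_b^k`: the functions that are bounded and `k` times continuously differentiable with bounded
derivatives up to order `k`. The derivative of order `0` is the function itself. -/
structure IsCb {E F : Type*} [NormedAddCommGroup E] [NormedSpace ℝ E]
    [NormedAddCommGroup F] [NormedSpace ℝ F] (k : ℕ) (f : E → F) : Prop where
  contDiff : ContDiff ℝ k f
  bounded : ∀ i ≤ k, ∃ C : ℝ, ∀ x, ‖iteratedFDeriv ℝ i f x‖ ≤ C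

/-- `C_b^{0,k}([0,T] × E; F)`: continuous in time and space, `k` times continuously
differentiable in space, with the function and its spatial derivatives up to order `k` bounded on
`[0,T] × E`. The values of `B` at times outside `[0,T]` play no role. -/
structure IsCbZero {E F : Type*} [NormedAddCommGroup E] [NormedSpace ℝ E]
    [NormedAddCommGroup F] [NormedSpace ℝ F] (k : ℕ) (T : ℝ) (B : ℝ → E → F) : Prop where
  continuousOn : ContinuousOn (fun p : ℝ × E => B p.1 p.2) (Icc 0 T ×ˢ univ)
  contDiff : ∀ t ∈ Icc 0 T, ContDiff ℝ k (B t)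
  bounded : ∀ i ≤ k, ∃ C : ℝ, ∀ t ∈ Icc 0 T, ∀ x, ‖iteratedFDeriv ℝ i (B t) x‖ ≤ C

/-- The partial derivative `∂_{j 0} ⋯ ∂_{j (h-1)} f` of order `h` of a scalar function. Every
multi-index of length `h` is represented by some `j`. -/
noncomputable def partialDeriv {N h : ℕ} (j : Fin h → Fin N)
    (f : EuclideanSpace ℝ (Fin N) → ℝ) (x : EuclideanSpace ℝ (Fin N)) : ℝ :=
  iteratedFDeriv ℝ h f x (fun l => EuclideanSpace.single (j l) (1 : ℝ))

/-- The supremum norm of a scalar function, with values in `[0, ∞]`. -/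
noncomputable def supNorm {E : Type*} (f : E → ℝ) : ℝ≥0∞ := ⨆ x, ‖f x‖ₑ

/-- The norm `‖f‖_∞ + ∑_{i=1}^n ‖∂^i f‖_∞`, with values in `[0, ∞]`, where `‖∂^i f‖_∞` is the
largest supremum norm of a partial derivative of order `i`. -/
noncomputable def cbNorm {N : ℕ} (n : ℕ) (f : EuclideanSpace ℝ (Fin N) → ℝ) : ℝ≥0∞ :=
  supNorm f + ∑ i ∈ Finset.Icc 1 n, ⨆ j : Fin i → Fin N, supNorm (partialDeriv j f)

/-! ### The driving noise -/

/-- Right-continuity and existence of left limits, relative to the index set `I`. -/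
def IsCadlagOn {ι E : Type*} [TopologicalSpace ι] [Preorder ι] [TopologicalSpace E]
    (f : ι → E) (I : Set ι) : Prop :=
  ∀ r ∈ I, ContinuousWithinAt f (I ∩ Ioi r) r ∧ ∃ l, Tendsto f (𝓝[I ∩ Iio r] r) (𝓝 l)

/-- A real Lévy process: it starts at zero, has independent and stationary increments, and its
paths are almost surely càdlàg. -/
structure IsLevyProcess {Ω : Type*} [MeasurableSpace Ω] (X : ℝ≥0 → Ω → ℝ) (μ : Measure Ω) :
    Prop where
  measurable : ∀ t, Measurable (X t)
  zero : ∀ᵐ ω ∂μ, X 0 ω = 0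
  indep : HasIndepIncrements X μ
  stationary : ∀ s t, IdentDistrib (fun ω => X (s + t) ω - X s ω) (X t) μ μ
  cadlag : ∀ᵐ ω ∂μ, IsCadlagOn (fun t => X t ω) univ

/-- A strictly `α`-stable subordinator: an increasing Lévy process whose characteristic function
at time `1` is `exp (-γ^α |u|^α (1 - i tan (π α / 2) sign u))` for some `γ > 0`. -/
structure IsStableSubordinator {Ω : Type*} [MeasurableSpace Ω] (α : ℝ) (L : ℝ≥0 → Ω → ℝ≥0)
    (μ : Measure Ω) : Prop where
  levy : IsLevyProcess (fun t ω => (L t ω : ℝ)) μ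
  mono : ∀ᵐ ω ∂μ, Monotone (fun t => L t ω)
  charFun_one : ∃ γ : ℝ, 0 < γ ∧ ∀ u : ℝ,
    ∫ ω, Complex.exp (Complex.I * ((u * (L 1 ω : ℝ) : ℝ) : ℂ)) ∂μ =
      Complex.exp (-((γ ^ α * |u| ^ α : ℝ) : ℂ) *
        (1 - Complex.I * ((Real.tan (Real.pi * α / 2) * Real.sign u : ℝ) : ℂ)))

/-- The subordinated process `W_L`, that is `t ↦ W_{L_t}` with `W = (β^1, …, β^N)`. -/
def subordinated {Ω : Type*} {N : ℕ} (β : Fin N → ℝ≥0 → Ω → ℝ) (L : ℝ≥0 → Ω → ℝ≥0)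
    (t : ℝ≥0) (ω : Ω) : EuclideanSpace ℝ (Fin N) :=
  WithLp.toLp 2 (fun i => β i (L t ω) ω)

/-- The minimal augmented filtration generated by a process `Z`: at time `t`, the σ-algebra
generated by `Z u`, `u ≤ t`, and by the negligible sets. -/
abbrev augmentedFiltration {Ω E : Type*} [MeasurableSpace Ω] [MeasurableSpace E]
    (Z : ℝ≥0 → Ω → E) (μ : Measure Ω) (t : ℝ≥0) : MeasurableSpace Ω :=
  (⨆ u : Iic t, MeasurableSpace.comap (Z u) inferInstance) ⊔
    MeasurableSpace.generateFrom {S : Set Ω | μ S = 0}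

/-- The standing assumptions on the noise: `β^1, …, β^N` are independent Brownian motions and `L`
is a strictly `α`-stable subordinator independent from `(β^1, …, β^N)`. -/
structure IsNoise {Ω : Type*} [MeasurableSpace Ω] {N : ℕ} (α : ℝ) (β : Fin N → ℝ≥0 → Ω → ℝ)
    (L : ℝ≥0 → Ω → ℝ≥0) (μ : Measure Ω) : Prop where
  brownian : ∀ i, IsBrownianReal (β i) μ
  indep_brownian : iIndepFun (fun i ω t => β i t ω) μ
  subordinator : IsStableSubordinator α L μ
  indep : IndepFun (fun ω t => L t ω) (fun ω i t => β i t ω) μ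

/-! ### The stochastic differential equation -/

/-- The diagonal matrix with entries `c`, acting on `ℝ^N`. -/
noncomputable def diagOp {N : ℕ} (c : Fin N → ℝ) :
    EuclideanSpace ℝ (Fin N) →L[ℝ] EuclideanSpace ℝ (Fin N) :=
  Matrix.toEuclideanCLM (𝕜 := ℝ) (Matrix.diagonal c)

/-- `X` solves, on `[s,T]` and with `X_s = x`, the equation
`dX_t = (A X_t + B (t, X_t)) dt + √Q dZ_t`, where `A = -diag (lam_1, …, lam_N)` and
`Q = diag (σ_1^2, …, σ_N^2)` with `σ_i > 0`: it is adapted to the minimal augmented filtration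
generated by `Z`, almost surely càdlàg, and almost surely satisfies the integral equation
simultaneously at all times `t ∈ [s,T]`. -/
structure IsSDESolution {Ω : Type*} [MeasurableSpace Ω] {N : ℕ} (μ : Measure Ω)
    (Z : ℝ≥0 → Ω → EuclideanSpace ℝ (Fin N)) (lam σ : Fin N → ℝ)
    (B : ℝ → EuclideanSpace ℝ (Fin N) → EuclideanSpace ℝ (Fin N)) (T s : ℝ)
    (x : EuclideanSpace ℝ (Fin N)) (X : ℝ → Ω → EuclideanSpace ℝ (Fin N)) : Prop where
  adapted : ∀ t ∈ Icc s T, Measurable[augmentedFiltration Z μ t.toNNReal] (X t)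
  cadlag : ∀ᵐ ω ∂μ, IsCadlagOn (fun t => X t ω) (Icc s T)
  equation : ∀ᵐ ω ∂μ, ∀ t ∈ Icc s T,
    X t ω = x + (∫ r in s..t, (diagOp (fun i => -lam i) (X r ω) + B r (X r ω)))
      + diagOp σ (Z t.toNNReal ω - Z s.toNNReal ω)

/-- The transition operators `P_{s,t} φ (x) = E[φ (X^{s,x}_t)]` of the family `X^{s,x}`. -/
noncomputable def transitionOp {Ω E : Type*} [MeasurableSpace Ω] (μ : Measure Ω)
    (X : ℝ → E → ℝ → Ω → E) (s t : ℝ) (φ : E → ℝ) (x : E) : ℝ :=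
  ∫ ω, φ (X s x t ω) ∂μ

/-!
Two solutions driven by the same noise path differ by a solution of an ordinary differential
equation, in which the noise enters only as the path of a reference solution. It therefore suffices
to bound the spatial derivatives of the flow of `y' = f(r, y)` uniformly over all fields `f` that
are merely measurable in time and have uniformly bounded spatial derivatives.

On the space of bounded continuous paths with the weight `exp (-c t)` the integral equation reads
`w = z + Ψ w` with a contraction `Ψ`, composed from bounded linear maps and the Nemytskii operator
`y ↦ f(·, y(·))`. That operator is as smooth from `L^∞` to `L^1` as `f` is in space, by induction
on the order, because its derivative is multiplication by the Nemytskii operator of `∂f`. The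
solution operator `R` of `w = z + Ψ w` has derivative `(1 - DΨ(R z))⁻¹`, and each order of
smoothness of `R` gives the next one. Restricting the Nemytskii operator to constant paths
differentiates the expectation under the integral sign.
-/

open scoped BoundedContinuousFunction

/-! ### Families with uniformly bounded derivatives -/

/-- A family of `k` times continuously differentiable functions whose derivatives of order
`l, …, k` are bounded uniformly over the family. -/
structure IsCbFamily {θ E F : Type*} [NormedAddCommGroup E] [NormedSpace ℝ E]
    [NormedAddCommGroup F] [NormedSpace ℝ F] (l k : ℕ) (u : θ → E → F) : Prop where
  contDiff : ∀ i, ContDiff ℝ k (u i)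
  bounded : ∀ j, l ≤ j → j ≤ k → ∃ C : ℝ, ∀ i x, ‖iteratedFDeriv ℝ j (u i) x‖ ≤ C

namespace IsCbFamily

variable {θ E F G H : Type*} [NormedAddCommGroup E] [NormedSpace ℝ E]
    [NormedAddCommGroup F] [NormedSpace ℝ F] [NormedAddCommGroup G] [NormedSpace ℝ G]
    [NormedAddCommGroup H] [NormedSpace ℝ H]

lemma mono {l l' k k' : ℕ} {u : θ → E → F} (h : IsCbFamily l k u) (hl : l ≤ l') (hk : k' ≤ k) :
    IsCbFamily l' k' u where
  contDiff i := (h.contDiff i).of_le (by exact_mod_cast hk)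
  bounded j hlj hjk := h.bounded j (hl.trans hlj) (hjk.trans hk)

lemma reindex {θ' : Type*} {l k : ℕ} {u : θ → E → F} (h : IsCbFamily l k u) (g : θ' → θ) :
    IsCbFamily l k fun i => u (g i) where
  contDiff i := h.contDiff (g i)
  bounded j hlj hjk := (h.bounded j hlj hjk).imp fun _ hC i => hC (g i)

lemma exists_bound {l k : ℕ} {u : θ → E → F} (h : IsCbFamily l k u) :
    ∃ C : ℝ, 1 ≤ C ∧ ∀ j, l ≤ j → j ≤ k → ∀ i x, ‖iteratedFDeriv ℝ j (u i) x‖ ≤ C := by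
  choose! C hC using h.bounded
  have hsum : 0 ≤ ∑ j ∈ Finset.range (k + 1), |C j| := Finset.sum_nonneg fun _ _ => abs_nonneg _
  refine ⟨1 + ∑ j ∈ Finset.range (k + 1), |C j|, by linarith, fun j hlj hjk i x => ?_⟩
  have hCj := Finset.single_le_sum (f := fun j => |C j|) (fun _ _ => abs_nonneg _)
    (Finset.mem_range.2 (Nat.lt_succ_of_le hjk))
  linarith [hC j hlj hjk i x, le_abs_self (C j)]

lemma exists_norm_le {k : ℕ} {u : θ → E → F} (h : IsCbFamily 0 k u) :
    ∃ C : ℝ, 0 ≤ C ∧ ∀ i x, ‖u i x‖ ≤ C := by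
  obtain ⟨C, hC1, hC⟩ := h.exists_bound
  exact ⟨C, by linarith, fun i x => by simpa using hC 0 le_rfl (Nat.zero_le _) i x⟩

lemma differentiable {l k : ℕ} {u : θ → E → F} (h : IsCbFamily l (k + 1) u) (i : θ) :
    Differentiable ℝ (u i) :=
  (h.contDiff i).differentiable (by simp)

lemma continuous {l k : ℕ} {u : θ → E → F} (h : IsCbFamily l k u) (i : θ) : Continuous (u i) :=
  (h.contDiff i).continuous

lemma fderiv {k : ℕ} {u : θ → E → F} (h : IsCbFamily 1 (k + 1) u) :
    IsCbFamily 0 k fun i => fderiv ℝ (u i) where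
  contDiff i := (h.contDiff i).fderiv_right (by norm_cast)
  bounded j _ hjk := by
    simp only [norm_iteratedFDeriv_fderiv]
    exact h.bounded (j + 1) (by omega) (by omega)

lemma of_hasFDerivAt {k : ℕ} {u : θ → E → F} {D : θ → E → E →L[ℝ] F}
    (hD : IsCbFamily 0 k D) (h : ∀ i x, HasFDerivAt (u i) (D i x) x) :
    IsCbFamily 1 (k + 1) u where
  contDiff i := by
    have hfderiv : _root_.fderiv ℝ (u i) = D i := funext fun x => (h i x).fderiv
    have := (contDiff_succ_iff_fderiv (𝕜 := ℝ) (n := k) (f := u i)).2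
      ⟨fun x => (h i x).differentiableAt, by simp, hfderiv ▸ hD.contDiff i⟩
    exact_mod_cast this
  bounded j hlj hjk := by
    obtain ⟨j, rfl⟩ : ∃ m, j = m + 1 := ⟨j - 1, by omega⟩
    have hfderiv : ∀ i, _root_.fderiv ℝ (u i) = D i := fun i => funext fun x => (h i x).fderiv
    simp only [← norm_iteratedFDeriv_fderiv, hfderiv]
    exact hD.bounded j (Nat.zero_le _) (by omega)

lemma of_norm_le {k : ℕ} {u : θ → E → F} (h : IsCbFamily 1 k u) {C : ℝ}
    (hC : ∀ i x, ‖u i x‖ ≤ C) : IsCbFamily 0 k u where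
  contDiff := h.contDiff
  bounded j _ hjk := by
    rcases Nat.eq_zero_or_pos j with rfl | hj
    · exact ⟨C, fun i x => by simpa using hC i x⟩
    · exact h.bounded j hj hjk

lemma of_continuous {u : θ → E → F} (h : ∀ i, Continuous (u i)) : IsCbFamily 1 0 u where
  contDiff i := contDiff_zero.2 (h i)
  bounded j hlj hjk := by omega

lemma comp {k : ℕ} {g : θ → F → G} {f : θ → E → F} (hg : IsCbFamily 0 k g)
    (hf : IsCbFamily 1 k f) : IsCbFamily 0 k fun i x => g i (f i x) where
  contDiff i := (hg.contDiff i).comp (hf.contDiff i)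
  bounded j _ hjk := by
    obtain ⟨C, -, hC⟩ := hg.exists_bound
    obtain ⟨D, hD1, hD⟩ := hf.exists_bound
    refine ⟨j.factorial * C * D ^ j, fun i x => ?_⟩
    refine norm_iteratedFDeriv_comp_le (hg.contDiff i) (hf.contDiff i) (by exact_mod_cast hjk) x
      (fun m hm => hC m (Nat.zero_le _) (hm.trans hjk) i _) fun m hm hm' => ?_
    exact (hD m hm (hm'.trans hjk) i x).trans (le_self_pow₀ hD1 (by omega))

lemma bilinear {k : ℕ} (B : F →L[ℝ] G →L[ℝ] H) {f : θ → E → F} {g : θ → E → G}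
    (hf : IsCbFamily 0 k f) (hg : IsCbFamily 0 k g) :
    IsCbFamily 0 k fun i x => B (f i x) (g i x) where
  contDiff i := (B.contDiff.comp (hf.contDiff i)).clm_apply (hg.contDiff i)
  bounded j _ hjk := by
    obtain ⟨C, hC1, hC⟩ := hf.exists_bound
    obtain ⟨D, -, hD⟩ := hg.exists_bound
    have : 0 ≤ C := zero_le_one.trans hC1
    refine ⟨‖B‖ * ∑ m ∈ Finset.range (j + 1), (j.choose m : ℝ) * C * D, fun i x => ?_⟩
    refine (B.norm_iteratedFDeriv_le_of_bilinear (hf.contDiff i) (hg.contDiff i) x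
      (by exact_mod_cast hjk)).trans ?_
    gcongr with m hm
    · exact hC m (Nat.zero_le _) (by have := Finset.mem_range.1 hm; omega) i x
    · exact hD (j - m) (Nat.zero_le _) (by omega) i x

lemma add {l k : ℕ} {f g : θ → E → F} (hf : IsCbFamily l k f) (hg : IsCbFamily l k g) :
    IsCbFamily l k fun i x => f i x + g i x where
  contDiff i := (hf.contDiff i).add (hg.contDiff i)
  bounded j hlj hjk := by
    obtain ⟨C, hC⟩ := hf.bounded j hlj hjk
    obtain ⟨D, hD⟩ := hg.bounded j hlj hjk
    refine ⟨C + D, fun i x => ?_⟩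
    have : (fun x => f i x + g i x) = f i + g i := rfl
    rw [this, iteratedFDeriv_add_apply ((hf.contDiff i).contDiffAt.of_le (by exact_mod_cast hjk))
      ((hg.contDiff i).contDiffAt.of_le (by exact_mod_cast hjk))]
    exact (norm_add_le _ _).trans (add_le_add (hC i x) (hD i x))

lemma exists_lipschitzWith {k : ℕ} {u : θ → E → F} (h : IsCbFamily 1 (k + 1) u) :
    ∃ C : ℝ≥0, ∀ i, LipschitzWith C (u i) := by
  obtain ⟨C, hC0, hC⟩ := h.fderiv.exists_norm_le
  exact ⟨⟨C, hC0⟩, fun i => lipschitzWith_of_nnnorm_fderiv_le (h.differentiable i) (hC i)⟩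

lemma clm_comp {l k : ℕ} {A : θ → F →L[ℝ] G} {C : ℝ} (hA : ∀ i, ‖A i‖ ≤ C) {f : θ → E → F}
    (hf : IsCbFamily l k f) : IsCbFamily l k fun i x => A i (f i x) where
  contDiff i := (A i).contDiff.comp (hf.contDiff i)
  bounded j hlj hjk := by
    obtain ⟨D, hD⟩ := hf.bounded j hlj hjk
    refine ⟨C * D, fun i x => ?_⟩
    refine ((A i).norm_iteratedFDeriv_comp_left (hf.contDiff i).contDiffAt
      (by exact_mod_cast hjk)).trans ?_
    exact mul_le_mul (hA i) (hD i x) (norm_nonneg _) ((norm_nonneg _).trans (hA i))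

lemma comp_clm {l k : ℕ} {f : θ → F → G} (hf : IsCbFamily l k f) (A : E →L[ℝ] F) :
    IsCbFamily l k fun i x => f i (A x) where
  contDiff i := (hf.contDiff i).comp A.contDiff
  bounded j hlj hjk := by
    obtain ⟨C, hC⟩ := hf.bounded j hlj hjk
    refine ⟨C * ‖A‖ ^ j, fun i x => ?_⟩
    have hcomp := A.iteratedFDeriv_comp_right (hf.contDiff i) x (i := j) (by exact_mod_cast hjk)
    simp only [Function.comp_def] at hcomp
    rw [hcomp]
    refine (ContinuousMultilinearMap.norm_compContinuousLinearMap_le _ _).trans ?_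
    rw [Finset.prod_const, Finset.card_univ, Fintype.card_fin]
    gcongr
    exact hC i _

lemma comp_const_add {l k : ℕ} {f : θ → E → F} (hf : IsCbFamily l k f) (c : θ → E) :
    IsCbFamily l k fun i x => f i (c i + x) where
  contDiff i := (hf.contDiff i).comp (contDiff_const.add contDiff_id)
  bounded j hlj hjk := (hf.bounded j hlj hjk).imp fun C hC i x => by
    rw [iteratedFDeriv_comp_add_left]
    exact hC i _

lemma const (k : ℕ) (c : θ → F) : IsCbFamily 1 k fun i (_ : E) => c i where
  contDiff _ := contDiff_const
  bounded j hlj _ := ⟨0, fun i x => by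
    rw [iteratedFDeriv_const_of_ne (by omega), Pi.zero_apply, norm_zero]⟩

lemma clm (k : ℕ) (A : E →L[ℝ] F) : IsCbFamily 1 (k + 1) fun (_ : θ) x => A x :=
  of_hasFDerivAt (D := fun _ _ => A) ((const k fun _ => A).of_norm_le fun _ _ => le_rfl)
    fun _ _ => A.hasFDerivAt

lemma indicator {l k : ℕ} {s : Set θ} {u : θ → E → F} (h : IsCbFamily l k fun i : s => u i) :
    IsCbFamily l k (s.indicator u) where
  contDiff i := by
    by_cases hi : i ∈ s
    · simpa only [indicator_of_mem hi] using h.contDiff ⟨i, hi⟩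
    · rw [indicator_of_notMem hi]
      exact contDiff_zero_fun
  bounded j hlj hjk := by
    obtain ⟨C, hC⟩ := h.bounded j hlj hjk
    refine ⟨max C 0, fun i x => ?_⟩
    by_cases hi : i ∈ s
    · simpa only [indicator_of_mem hi] using le_max_of_le_left (hC ⟨i, hi⟩ x)
    · simp [indicator_of_notMem hi]

end IsCbFamily

/-! ### Nemytskii operators -/

section Measurability

variable {S E F : Type*} [MeasurableSpace S] {ν : Measure S}
  [NormedAddCommGroup E] [NormedAddCommGroup F]

lemma aestronglyMeasurable_eval {f : S → E → F} (hf : ∀ᵐ r ∂ν, Continuous (f r))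
    (hm : ∀ x, AEStronglyMeasurable (fun r => f r x) ν) {y : S → E}
    (hy : AEStronglyMeasurable y ν) : AEStronglyMeasurable (fun r => f r (y r)) ν := by
  obtain ⟨z, hz, hyz⟩ := hy
  suffices h : AEStronglyMeasurable (fun r => f r (z r)) ν from
    h.congr (hyz.mono fun r hr => by simp only [hr])
  have hsimple (g : SimpleFunc S E) : AEStronglyMeasurable (fun r => f r (g r)) ν := by
    have hsum : (fun r => f r (g r)) =
        fun r => ∑ v ∈ g.range, (g ⁻¹' {v}).indicator (fun r => f r v) r := by
      funext r
      rw [Finset.sum_eq_single_of_mem (g r) (g.mem_range_self r)]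
      · simp
      · intro v _ hv
        exact indicator_of_notMem (fun h => hv h.symm) _
    rw [hsum]
    exact Finset.aestronglyMeasurable_fun_sum _ fun v _ =>
      (hm v).indicator (g.measurableSet_fiber v)
  exact aestronglyMeasurable_of_tendsto_ae atTop (fun n => hsimple (hz.approx n)) <|
    hf.mono fun r hr => (hr.tendsto _).comp (hz.tendsto_approx r)

variable [NormedSpace ℝ E] [FiniteDimensional ℝ E] [NormedSpace ℝ F]

lemma aestronglyMeasurable_clm_of_apply {A : S → E →L[ℝ] F}
    (h : ∀ v, AEStronglyMeasurable (fun r => A r v) ν) : AEStronglyMeasurable A ν := by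
  let b := Module.finBasis ℝ E
  let c (i) : E →L[ℝ] ℝ := (b.coord i).toContinuousLinearMap
  have hA : A = fun r => ∑ i, ContinuousLinearMap.smulRightL ℝ E F (c i) (A r (b i)) := by
    funext r
    ext v
    conv_lhs => rw [← b.sum_repr v, map_sum]
    simp [c]
  rw [hA]
  exact Finset.aestronglyMeasurable_fun_sum _ fun i _ =>
    (ContinuousLinearMap.smulRightL ℝ E F (c i)).continuous.comp_aestronglyMeasurable (h _)

lemma aestronglyMeasurable_fderiv {f : S → E → F} (hd : ∀ r, Differentiable ℝ (f r))
    (hm : ∀ x, AEStronglyMeasurable (fun r => f r x) ν) (x : E) :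
    AEStronglyMeasurable (fun r => fderiv ℝ (f r) x) ν := by
  refine aestronglyMeasurable_clm_of_apply fun v => ?_
  exact aestronglyMeasurable_of_tendsto_ae atTop (f := fun (n : ℕ) r =>
    (n : ℝ) • (f r (x + (n : ℝ)⁻¹ • v) - f r x)) (fun n => ((hm _).sub (hm _)).const_smul _) <|
    Eventually.of_forall fun r =>
      ((hd r x).hasFDerivAt.lim_real v).comp tendsto_natCast_atTop_atTop

end Measurability

section Nemytskii

universe u

variable {S : Type*} [MeasurableSpace S] {ν : Measure S}
  {E F : Type u} [NormedAddCommGroup E] [NormedAddCommGroup F]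

open Classical in
/-- The Nemytskii operator `y ↦ f(·, y(·))` from `L^∞` to `L^1`, with the junk value `0` where
`f(·, y(·))` is not integrable. -/
noncomputable def nemytskii (ν : Measure S) (f : S → E → F) (y : Lp E ∞ ν) : Lp F 1 ν :=
  if h : MemLp (fun r => f r (y r)) 1 ν then h.toLp else 0

lemma coeFn_nemytskii {f : S → E → F} {y : Lp E ∞ ν}
    (h : Integrable (fun r => f r (y r)) ν) : nemytskii ν f y =ᵐ[ν] fun r => f r (y r) := by
  rw [nemytskii, dif_pos (memLp_one_iff_integrable.2 h)]
  exact MemLp.coeFn_toLp _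

lemma ae_norm_le_norm_Lp_top (y : Lp E ∞ ν) : ∀ᵐ r ∂ν, ‖y r‖ ≤ ‖y‖ := by
  filter_upwards [ae_le_eLpNormEssSup (f := y) (μ := ν)] with r hr
  rw [Lp.norm_def, eLpNorm_exponent_top]
  exact ENNReal.toReal_mono (by simpa using (Lp.memLp y).eLpNorm_ne_top) hr |>.trans_eq' (by simp)

lemma ae_norm_sub_le_norm_sub_Lp_top (z y : Lp E ∞ ν) : ∀ᵐ r ∂ν, ‖z r - y r‖ ≤ ‖z - y‖ := by
  filter_upwards [ae_norm_le_norm_Lp_top (z - y), Lp.coeFn_sub z y] with r hr hsub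
  rwa [hsub] at hr

lemma ae_tendsto_of_tendsto_Lp_top {z : ℕ → Lp E ∞ ν} {y : Lp E ∞ ν}
    (hz : Tendsto z atTop (𝓝 y)) : ∀ᵐ r ∂ν, Tendsto (fun n => z n r) atTop (𝓝 (y r)) := by
  have hle : ∀ᵐ r ∂ν, ∀ n, ‖z n r - y r‖ ≤ ‖z n - y‖ :=
    ae_all_iff.2 fun n => ae_norm_sub_le_norm_sub_Lp_top (z n) y
  filter_upwards [hle] with r hr
  exact tendsto_iff_norm_sub_tendsto_zero.2 <|
    squeeze_zero (fun _ => norm_nonneg _) hr (tendsto_iff_norm_sub_tendsto_zero.1 hz)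

lemma norm_Lp_one_eq_integral_norm {g : Lp F 1 ν} {h : S → F} (hgh : g =ᵐ[ν] h) :
    ‖g‖ = ∫ r, ‖h r‖ ∂ν := by
  rw [L1.norm_eq_integral_norm]
  exact integral_congr_ae (hgh.mono fun r hr => congrArg norm hr)

section Bounded

variable [IsFiniteMeasure ν] {f : S → E → F} {C : ℝ} (hf : ∀ r, Continuous (f r))
  (hm : ∀ x, AEStronglyMeasurable (fun r => f r x) ν) (hC : ∀ r x, ‖f r x‖ ≤ C)

include hf hm hC

lemma integrable_eval_of_bounded (y : Lp E ∞ ν) : Integrable (fun r => f r (y r)) ν :=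
  .of_bound (aestronglyMeasurable_eval (ae_of_all _ hf) hm (Lp.aestronglyMeasurable y)) C
    (Eventually.of_forall fun r => hC r (y r))

lemma norm_nemytskii_le (y : Lp E ∞ ν) : ‖nemytskii ν f y‖ ≤ C * ν.real univ := by
  have hint := integrable_eval_of_bounded hf hm hC y
  rw [norm_Lp_one_eq_integral_norm (coeFn_nemytskii hint)]
  refine (integral_mono hint.norm (integrable_const C) fun r => hC r _).trans_eq ?_
  rw [integral_const, smul_eq_mul, mul_comm]

lemma continuous_nemytskii : Continuous (nemytskii ν f) := by
  have hint := integrable_eval_of_bounded hf hm hC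
  refine continuous_iff_continuousAt.2 fun y => tendsto_of_seq_tendsto fun z hz => ?_
  have hnorm (n : ℕ) : ‖nemytskii ν f (z n) - nemytskii ν f y‖ =
      ∫ r, ‖f r (z n r) - f r (y r)‖ ∂ν :=
    norm_Lp_one_eq_integral_norm <| (Lp.coeFn_sub _ _).trans <|
      (coeFn_nemytskii (hint (z n))).sub (coeFn_nemytskii (hint y))
  rw [tendsto_iff_norm_sub_tendsto_zero]
  simp only [Function.comp_apply, hnorm]
  rw [← integral_zero S ℝ]
  refine tendsto_integral_of_dominated_convergence (fun _ => C + C)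
    (fun n => ((hint (z n)).sub (hint y)).norm.aestronglyMeasurable) (integrable_const _)
    (fun n => Eventually.of_forall fun r => ?_) ?_
  · rw [norm_norm]
    exact norm_sub_le_of_le (hC r _) (hC r _)
  · filter_upwards [ae_tendsto_of_tendsto_Lp_top hz] with r hr
    exact tendsto_iff_norm_sub_tendsto_zero.1 (((hf r).tendsto _).comp hr)

end Bounded

section Derivative

variable [NormedSpace ℝ E] [NormedSpace ℝ F]

/-- The candidate for the derivative of the Nemytskii operator of `f` at `y`: multiplication by
`∂f(·, y(·))`, from `L^∞` to `L^1`. -/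
noncomputable def nemytskiiFDeriv (ν : Measure S) (f : S → E → F) (y : Lp E ∞ ν) :
    Lp E ∞ ν →L[ℝ] Lp F 1 ν :=
  (ContinuousLinearMap.id ℝ (E →L[ℝ] F)).holderL ν 1 ∞ 1
    (nemytskii ν (fun r => fderiv ℝ (f r)) y)

end Derivative

section Lipschitz

variable [IsFiniteMeasure ν] {f : S → E → F} {C : ℝ≥0} (hf : ∀ r, LipschitzWith C (f r))
  (hm : ∀ x, AEStronglyMeasurable (fun r => f r x) ν) {C₀ : ℝ} (hf0 : ∀ r, ‖f r 0‖ ≤ C₀)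

include hf hm hf0

lemma integrable_eval_of_lipschitz (y : Lp E ∞ ν) : Integrable (fun r => f r (y r)) ν := by
  have hlin (r : S) (x : E) : ‖f r x‖ ≤ C₀ + C * ‖x‖ := by
    have := (hf r).norm_sub_le x 0
    rw [sub_zero] at this
    linarith [norm_le_norm_add_norm_sub' (f r x) (f r 0), hf0 r]
  refine .of_bound (aestronglyMeasurable_eval (ae_of_all _ fun r => (hf r).continuous) hm
    (Lp.aestronglyMeasurable y)) (C₀ + C * ‖y‖) ?_
  filter_upwards [ae_norm_le_norm_Lp_top y] with r hr
  exact (hlin r _).trans (by gcongr)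

variable [NormedSpace ℝ E] [FiniteDimensional ℝ E] [NormedSpace ℝ F]
  (hd : ∀ r, Differentiable ℝ (f r)) (hD : ∀ r, Continuous (fderiv ℝ (f r)))

include hd hD

lemma coeFn_nemytskii_sub_sub (z y : Lp E ∞ ν) :
    nemytskii ν f z - nemytskii ν f y - nemytskiiFDeriv ν f y (z - y) =ᵐ[ν]
      fun r => f r (z r) - f r (y r) - fderiv ℝ (f r) (y r) (z r - y r) := by
  have hint := integrable_eval_of_lipschitz hf hm hf0
  have hfderiv : nemytskiiFDeriv ν f y (z - y) =ᵐ[ν]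
      fun r => fderiv ℝ (f r) (y r) (z r - y r) := by
    filter_upwards [ContinuousLinearMap.coeFn_holder (r := 1) (.id ℝ (E →L[ℝ] F))
      (nemytskii ν (fun r => fderiv ℝ (f r)) y) (z - y), Lp.coeFn_sub z y,
      coeFn_nemytskii (integrable_eval_of_bounded hD (aestronglyMeasurable_fderiv hd hm)
        (fun r _ => norm_fderiv_le_of_lipschitz ℝ (hf r)) y)] with r hholder hsub hfr
    rwa [hsub, hfr] at hholder
  exact (Lp.coeFn_sub _ _).trans <| ((Lp.coeFn_sub _ _).trans <|
    (coeFn_nemytskii (hint z)).sub (coeFn_nemytskii (hint y))).sub hfderiv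

lemma hasFDerivAt_nemytskii (y : Lp E ∞ ν) :
    HasFDerivAt (nemytskii ν f) (nemytskiiFDeriv ν f y) y := by
  let R (z : Lp E ∞ ν) (r : S) : F := f r (z r) - f r (y r) - fderiv ℝ (f r) (y r) (z r - y r)
  have hR (z : Lp E ∞ ν) := coeFn_nemytskii_sub_sub hf hm hf0 hd hD z y
  have hRint (z : Lp E ∞ ν) : Integrable (R z) ν := (L1.integrable_coeFn _).congr (hR z)
  have hRle (z : Lp E ∞ ν) (r : S) : ‖R z r‖ ≤ 2 * C * ‖z r - y r‖ := by
    refine (norm_sub_le_of_le ((hf r).norm_sub_le _ _)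
      (ContinuousLinearMap.le_of_opNorm_le _
        (norm_fderiv_le_of_lipschitz ℝ (hf r)) _)).trans_eq (by ring)
  rw [hasFDerivAt_iff_tendsto]
  refine tendsto_of_seq_tendsto fun z hz => ?_
  have hle : ∀ᵐ r ∂ν, ∀ n, ‖z n r - y r‖ ≤ ‖z n - y‖ :=
    ae_all_iff.2 fun n => ae_norm_sub_le_norm_sub_Lp_top (z n) y
  simp only [Function.comp_def, norm_Lp_one_eq_integral_norm (hR _), ← integral_const_mul]
  rw [← integral_zero S ℝ]
  refine tendsto_integral_of_dominated_convergence (fun _ => 2 * C)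
    (fun n => ((hRint (z n)).norm.const_mul _).aestronglyMeasurable) (integrable_const _)
    (fun n => ?_) ?_
  · filter_upwards [hle] with r hr
    rw [norm_mul, norm_inv, norm_norm, norm_norm]
    refine inv_mul_le_of_le_mul₀ (norm_nonneg _) (by positivity) ?_
    refine (hRle (z n) r).trans ?_
    rw [mul_comm]
    gcongr
    exact hr n
  · filter_upwards [hle, ae_tendsto_of_tendsto_Lp_top hz] with r hr htend
    refine squeeze_zero (fun n => by positivity) (fun n => ?_)
      ((hasFDerivAt_iff_tendsto.1 (hd r (y r)).hasFDerivAt).comp htend)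
    rcases eq_or_ne (z n r) (y r) with h | h
    · simp [h]
    · have := norm_pos_iff.2 (sub_ne_zero.2 h)
      dsimp only [Function.comp]
      gcongr
      exact hr n

end Lipschitz

section Family

variable [NormedSpace ℝ E] [FiniteDimensional ℝ E] [NormedSpace ℝ F]
  [IsFiniteMeasure ν] {θ : Type*}

lemma isCbFamily_nemytskii_of_fderiv {k : ℕ} {f : θ → S → E → F}
    (hf : IsCbFamily 1 (k + 1) fun p : θ × S => f p.1 p.2)
    (hm : ∀ i x, AEStronglyMeasurable (fun r => f i r x) ν) {C₀ : ℝ} (hf0 : ∀ i r, ‖f i r 0‖ ≤ C₀)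
    (hD : IsCbFamily 0 k fun i => nemytskii ν fun r => fderiv ℝ (f i r)) :
    IsCbFamily 1 (k + 1) fun i => nemytskii ν (f i) := by
  obtain ⟨C, hC⟩ := hf.exists_lipschitzWith
  exact .of_hasFDerivAt (D := fun i => nemytskiiFDeriv ν (f i)) (hD.clm_comp fun _ => le_rfl)
    fun i => hasFDerivAt_nemytskii (fun r => hC (i, r)) (hm i) (hf0 i)
      (fun r => hf.differentiable (i, r)) fun r => hf.fderiv.continuous (i, r)

theorem isCbFamily_zero_nemytskii {k : ℕ} {F : Type u} [NormedAddCommGroup F] [NormedSpace ℝ F]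
    {f : θ → S → E → F} (hf : IsCbFamily 0 k fun p : θ × S => f p.1 p.2)
    (hm : ∀ i x, AEStronglyMeasurable (fun r => f i r x) ν) :
    IsCbFamily 0 k fun i => nemytskii ν (f i) := by
  obtain ⟨C, -, hC⟩ := hf.exists_norm_le
  have hcont (i : θ) (r : S) := hf.continuous (i, r)
  have hbound (i : θ) := norm_nemytskii_le (hcont i) (hm i) fun r => hC (i, r)
  -- The derivative takes values in `E →L[ℝ] F`: hence the common universe of `E` and `F`.
  induction k generalizing F C with
  | zero =>
    exact (IsCbFamily.of_continuous fun i => continuous_nemytskii (hcont i) (hm i)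
      fun r => hC (i, r)).of_norm_le hbound
  | succ k ih =>
    have hf' := hf.mono zero_le_one le_rfl
    obtain ⟨C', -, hC'⟩ := hf'.fderiv.exists_norm_le
    have hm' (i : θ) := aestronglyMeasurable_fderiv (fun r => hf'.differentiable (i, r)) (hm i)
    have hD := ih hf'.fderiv hm' C' hC' (fun i r => hf'.fderiv.continuous (i, r))
      fun i => norm_nemytskii_le (fun r => hf'.fderiv.continuous (i, r)) (hm' i)
        fun r => hC' (i, r)
    exact (isCbFamily_nemytskii_of_fderiv hf' hm (fun i r => hC (i, r) 0) hD).of_norm_le hbound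

theorem isCbFamily_one_nemytskii {k : ℕ} {f : θ → S → E → F}
    (hf : IsCbFamily 1 (k + 1) fun p : θ × S => f p.1 p.2)
    (hm : ∀ i x, AEStronglyMeasurable (fun r => f i r x) ν) {C₀ : ℝ}
    (hf0 : ∀ i r, ‖f i r 0‖ ≤ C₀) :
    IsCbFamily 1 (k + 1) fun i => nemytskii ν (f i) :=
  isCbFamily_nemytskii_of_fderiv hf hm hf0 <| isCbFamily_zero_nemytskii hf.fderiv fun i =>
    aestronglyMeasurable_fderiv (fun r => hf.differentiable (i, r)) (hm i)

theorem isCbFamily_integral {k : ℕ} [CompleteSpace F] {f : θ → S → E → F}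
    (hf : IsCbFamily 0 k fun p : θ × S => f p.1 p.2)
    (hm : ∀ i x, AEStronglyMeasurable (fun r => f i r x) ν) :
    IsCbFamily 0 k fun i x => ∫ r, f i r x ∂ν := by
  obtain ⟨C, -, hC⟩ := hf.exists_norm_le
  have heq (i : θ) (x : E) : ∫ r, f i r x ∂ν =
      L1.integralCLM (nemytskii ν (f i) (Lp.constL ∞ ν ℝ x)) := by
    have hint := integrable_eval_of_bounded (fun r => hf.continuous (i, r)) (hm i)
      (fun r => hC (i, r)) (Lp.constL ∞ ν ℝ x)
    rw [← L1.integral_eq, L1.integral_eq_integral, integral_congr_ae (coeFn_nemytskii hint)]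
    exact integral_congr_ae ((Lp.coeFn_const ∞ ν x).mono fun r hr => congrArg (f i r) hr.symm)
  simp only [heq]
  exact ((isCbFamily_zero_nemytskii hf hm).comp_clm _).clm_comp fun _ => le_rfl

end Family

end Nemytskii

/-! ### Resolvents of contractions -/

lemma hasFDerivAt_resolvent {X : Type*} [NormedAddCommGroup X] [NormedSpace ℝ X]
    [CompleteSpace X] {Ψ R : X → X} {c : ℝ≥0} (hc : c < 1) (hΨ : LipschitzWith c Ψ)
    (hd : Differentiable ℝ Ψ) (hR : ∀ z, R z = z + Ψ (R z)) (hRc : Continuous R) (z : X) :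
    HasFDerivAt R (Ring.inverse (1 - fderiv ℝ Ψ (R z))) z := by
  have hlt : ‖fderiv ℝ Ψ (R z)‖ < 1 :=
    (norm_fderiv_le_of_lipschitz ℝ hΨ).trans_lt (by exact_mod_cast hc)
  let e := ContinuousLinearEquiv.ofUnit (Units.oneSub _ hlt)
  have := HasFDerivAt.of_local_left_inverse (f' := e) (f := fun w => w - Ψ w) (g := R) (a := z)
    hRc.continuousAt ((hasFDerivAt_id _).sub (hd _).hasFDerivAt)
    (Eventually.of_forall fun z => sub_eq_of_eq_add (hR z))
  have he : (e.symm : X →L[ℝ] X) = Ring.inverse (1 - fderiv ℝ Ψ (R z)) :=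
    (Ring.inverse_unit (Units.oneSub _ hlt)).symm
  rwa [he] at this

namespace IsCbFamily

lemma inverse_one_sub {θ E 𝔸 : Type*} [NormedAddCommGroup E] [NormedSpace ℝ E] [NormedRing 𝔸]
    [NormedAlgebra ℝ 𝔸] [CompleteSpace 𝔸] {k : ℕ} {u : θ → E → 𝔸} (hu : IsCbFamily 0 k u)
    {c : ℝ} (hc : c < 1) (huc : ∀ i x, ‖u i x‖ ≤ c) :
    IsCbFamily 0 k fun i x => Ring.inverse (1 - u i x) := by
  have hlt (i : θ) (x : E) : ‖u i x‖ < 1 := (huc i x).trans_lt hc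
  have hinv (i : θ) (x : E) : Ring.inverse (1 - u i x) = ∑' n : ℕ, u i x ^ n :=
    NormedRing.inverse_one_sub (u i x) (hlt i x) ▸ Ring.inverse_unit (.oneSub (u i x) (hlt i x))
  have hbound (i : θ) (x : E) : ‖Ring.inverse (1 - u i x)‖ ≤ ‖(1 : 𝔸)‖ - 1 + (1 - c)⁻¹ := by
    rw [hinv]
    refine (tsum_geometric_le_of_norm_lt_one _ (hlt i x)).trans ?_
    have := sub_pos.2 hc
    gcongr
    exact huc i x
  have hderiv (i : θ) (x : E) : HasFDerivAt Ring.inverse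
      (-ContinuousLinearMap.mulLeftRight ℝ 𝔸 (Ring.inverse (1 - u i x))
        (Ring.inverse (1 - u i x))) (1 - u i x) := by
    have := hasFDerivAt_ringInverse (𝕜 := ℝ) (Units.oneSub (u i x) (hlt i x))
    rwa [← Ring.inverse_unit] at this
  induction k with
  | zero =>
    refine (of_continuous fun i => ?_).of_norm_le hbound
    exact continuous_iff_continuousAt.2 fun x => (hderiv i x).continuousAt.comp
      (f := fun x => 1 - u i x) (continuousAt_const.sub (hu.continuous i).continuousAt)
  | succ k ih =>
    have hv := ih (hu.mono le_rfl k.le_succ)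
    have hu' := hu.mono zero_le_one le_rfl
    have hmul := hv.bilinear (ContinuousLinearMap.mulLeftRight ℝ 𝔸) hv
    refine (of_hasFDerivAt (hmul.bilinear (ContinuousLinearMap.compL ℝ E 𝔸 𝔸) hu'.fderiv)
      fun i x => ?_).of_norm_le hbound
    refine ((hderiv i x).comp x
      ((hu'.differentiable i x).hasFDerivAt.const_sub 1)).congr_fderiv ?_
    ext v
    simp

theorem exists_resolvent {θ X : Type*} [NormedAddCommGroup X] [NormedSpace ℝ X] [CompleteSpace X]
    {k : ℕ} {Ψ : θ → X → X} (hΨ : IsCbFamily 1 (k + 1) Ψ) {c : ℝ≥0} (hc : c < 1)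
    (hlip : ∀ i, LipschitzWith c (Ψ i)) :
    ∃ R : θ → X → X, IsCbFamily 1 (k + 1) R ∧ ∀ i z w, w = z + Ψ i w ↔ w = R i z := by
  have hcontr (i : θ) (z : X) : ContractingWith c fun w => z + Ψ i w :=
    ⟨hc, by simpa using (LipschitzWith.const z).add (hlip i)⟩
  let R (i : θ) (z : X) : X := (hcontr i z).fixedPoint
  have hR (i : θ) (z w : X) : w = z + Ψ i w ↔ w = R i z :=
    ⟨fun h => (hcontr i z).fixedPoint_unique h.symm, fun h => h ▸
      (hcontr i z).fixedPoint_isFixedPt.symm⟩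
  have hRcont (i : θ) : Continuous (R i) :=
    (LipschitzWith.of_dist_le' (K := (1 - c : ℝ)⁻¹) fun z z' => by
      rw [inv_mul_eq_div]
      exact (hcontr i z).fixedPoint_lipschitz_in_map (hcontr i z') fun w => by simp).continuous
  have hderiv (i : θ) := hasFDerivAt_resolvent hc (hlip i) (hΨ.differentiable i)
    (fun z => (hR i z _).2 rfl) (hRcont i)
  have hinv : IsCbFamily 0 k fun i w => Ring.inverse (1 - _root_.fderiv ℝ (Ψ i) w) :=
    hΨ.fderiv.inverse_one_sub (by exact_mod_cast hc) fun i w =>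
      norm_fderiv_le_of_lipschitz ℝ (hlip i)
  refine ⟨R, ?_, hR⟩
  induction k with
  | zero =>
    exact of_hasFDerivAt (hinv.comp (of_continuous hRcont)) hderiv
  | succ k ih =>
    have := ih (hΨ.mono le_rfl (Nat.le_succ _)) (hinv.mono le_rfl k.le_succ)
    exact of_hasFDerivAt (hinv.comp this) hderiv

end IsCbFamily

/-! ### Ordinary differential equations -/

section Volterra

universe u

variable {E : Type u} [NormedAddCommGroup E] [NormedSpace ℝ E] {ν : Measure ℝ}

lemma continuous_integral_Iic [NullSingletonClass ν] {g : ℝ → E} (hg : Integrable g ν) :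
    Continuous fun t => ∫ r in Iic t, g r ∂ν := by
  have heq : (fun t => ∫ r in Iic t, g r ∂ν) =
      fun t => (∫ r in Iic 0, g r ∂ν) + ∫ r in (0 : ℝ)..t, g r ∂ν := funext fun t => by
    rw [← intervalIntegral.integral_Iic_sub_Iic hg.integrableOn hg.integrableOn,
      add_sub_cancel]
  rw [heq]
  exact continuous_const.add
    (intervalIntegral.continuous_primitive (fun _ _ => hg.intervalIntegrable) 0)

lemma norm_integral_Iic_le (g : Lp E 1 ν) (t : ℝ) : ‖∫ r in Iic t, g r ∂ν‖ ≤ ‖g‖ := by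
  rw [L1.norm_eq_integral_norm]
  exact (norm_integral_le_integral_norm _).trans <| setIntegral_le_integral
    (L1.integrable_coeFn g).norm (ae_of_all _ fun _ => norm_nonneg _)

/-- The primitive `g ↦ (t ↦ ∫ r in Iic t, g r ∂ν)`, from `L^1` to bounded continuous functions. -/
noncomputable def volterra (ν : Measure ℝ) [NullSingletonClass ν] :
    Lp E 1 ν →L[ℝ] ℝ →ᵇ E :=
  LinearMap.mkContinuous
    { toFun := fun g => .ofNormedAddCommGroup (fun t => ∫ r in Iic t, g r ∂ν)
        (continuous_integral_Iic (L1.integrable_coeFn g)) ‖g‖ (norm_integral_Iic_le g)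
      map_add' := fun g h => BoundedContinuousFunction.ext fun t => by
        refine (integral_congr_ae (ae_restrict_of_ae (Lp.coeFn_add g h))).trans ?_
        exact integral_add (L1.integrable_coeFn g).integrableOn (L1.integrable_coeFn h).integrableOn
      map_smul' := fun c g => BoundedContinuousFunction.ext fun t => by
        refine (integral_congr_ae (ae_restrict_of_ae (Lp.coeFn_smul c g))).trans ?_
        exact integral_smul c g }
    1 fun g => (BoundedContinuousFunction.norm_ofNormedAddCommGroup_le _ (norm_nonneg g)
      (norm_integral_Iic_le g)).trans_eq (one_mul ‖g‖).symm

lemma volterra_apply [NullSingletonClass ν] {g : Lp E 1 ν} {h : ℝ → E} (hgh : g =ᵐ[ν] h) (t : ℝ) :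
    volterra ν g t = ∫ r in Iic t, h r ∂ν :=
  integral_congr_ae (ae_restrict_of_ae hgh)

end Volterra

section Weight

/-- The function `exp (c t)` on `[0, T]`, continued by constants. -/
noncomputable def expWeight (T c : ℝ) : ℝ →ᵇ ℝ :=
  .ofNormedAddCommGroup (fun t => Real.exp (c * max 0 (min t T))) (by fun_prop)
    (Real.exp (|c| * max 0 T)) fun t => by
      rw [Real.norm_of_nonneg (Real.exp_nonneg _)]
      gcongr
      exacts [le_abs_self c, min_le_right t T]

lemma expWeight_apply (T c t : ℝ) : expWeight T c t = Real.exp (c * max 0 (min t T)) := rfl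

lemma expWeight_nonneg (T c t : ℝ) : 0 ≤ expWeight T c t := Real.exp_nonneg _

lemma expWeight_mul_expWeight_neg (T c t : ℝ) : expWeight T c t * expWeight T (-c) t = 1 := by
  rw [expWeight_apply, expWeight_apply, ← Real.exp_add, neg_mul, add_neg_cancel, Real.exp_zero]

lemma expWeight_smul_expWeight_neg_smul {E : Type*} [NormedAddCommGroup E] [NormedSpace ℝ E]
    (T c : ℝ) (w : ℝ →ᵇ E) : expWeight T c • expWeight T (-c) • w = w := by
  ext t
  change expWeight T c t • expWeight T (-c) t • w t = w t
  rw [smul_smul, expWeight_mul_expWeight_neg, one_smul]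

lemma integral_Iic_expWeight_le (T t : ℝ) {c : ℝ} (hc : 0 < c) :
    ∫ r in Iic t, expWeight T c r ∂volume.restrict (Icc 0 T) ≤ expWeight T c t / c := by
  rw [Measure.restrict_restrict measurableSet_Iic, expWeight_apply, ← integral_exp_mul_Iic hc]
  have hsub : Iic t ∩ Icc 0 T ⊆ Iic (max 0 (min t T)) := fun r hr =>
    le_max_of_le_right (le_min hr.1 hr.2.2)
  have heq : EqOn (expWeight T c) (fun r => Real.exp (c * r)) (Iic t ∩ Icc 0 T) := fun r hr => by
    rw [expWeight_apply, min_eq_left hr.2.2, max_eq_right hr.2.1]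
  rw [setIntegral_congr_fun (measurableSet_Iic.inter measurableSet_Icc) heq]
  exact setIntegral_mono_set (integrableOn_exp_mul_Iic hc _)
    (ae_of_all _ fun r => Real.exp_nonneg _) hsub.eventuallyLE

end Weight

section Flow

universe u

variable {E : Type u} [NormedAddCommGroup E] [NormedSpace ℝ E]

/-- The integral operator `y ↦ ∫ r in 0..t, f r (y r)` on bounded paths, conjugated by the weight
`exp (c t)`: it is a contraction when `c` exceeds the Lipschitz constant of `f`. -/
noncomputable def weightedVolterra (T c : ℝ) (f : ℝ → E → E) (w : ℝ →ᵇ E) : ℝ →ᵇ E :=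
  expWeight T (-c) • volterra _ (nemytskii (volume.restrict (Icc 0 T)) f
    (BoundedContinuousFunction.toLp ∞ _ ℝ (expWeight T c • w)))

lemma coeFn_nemytskii_toLp {T : ℝ} {f : ℝ → E → E} {y : ℝ →ᵇ E}
    (h : Integrable (fun r => f r (y r)) (volume.restrict (Icc 0 T))) :
    nemytskii _ f (BoundedContinuousFunction.toLp ∞ (volume.restrict (Icc 0 T)) ℝ y)
      =ᵐ[volume.restrict (Icc 0 T)] fun r => f r (y r) := by
  have heq : (fun r => f r (BoundedContinuousFunction.toLp ∞ (volume.restrict (Icc 0 T)) ℝ y r))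
      =ᵐ[volume.restrict (Icc 0 T)] fun r => f r (y r) :=
    (BoundedContinuousFunction.coeFn_toLp ∞ _ ℝ y).mono fun r hr => congrArg (f r) hr
  exact (coeFn_nemytskii (h.congr heq.symm)).trans heq

lemma integrable_eval_boundedContinuousFunction {ν : Measure ℝ} [IsFiniteMeasure ν] {K : ℝ≥0}
    {f : ℝ → E → E} (hf : ∀ r, LipschitzWith K (f r))
    (hm : ∀ x, AEStronglyMeasurable (fun r => f r x) ν) {C₀ : ℝ} (hf0 : ∀ r, ‖f r 0‖ ≤ C₀)
    (y : ℝ →ᵇ E) : Integrable (fun r => f r (y r)) ν :=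
  (integrable_eval_of_lipschitz hf hm hf0 (BoundedContinuousFunction.toLp ∞ ν ℝ y)).congr <|
    (BoundedContinuousFunction.coeFn_toLp ∞ ν ℝ y).mono fun r hr => congrArg (f r) hr

lemma lipschitzWith_weightedVolterra {T : ℝ} {c K : ℝ≥0} (hc : 0 < c) {f : ℝ → E → E}
    (hf : ∀ r, LipschitzWith K (f r))
    (hm : ∀ x, AEStronglyMeasurable (fun r => f r x) (volume.restrict (Icc 0 T))) {C₀ : ℝ}
    (hf0 : ∀ r, ‖f r 0‖ ≤ C₀) :
    LipschitzWith (K / c) (weightedVolterra T c f) := by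
  have hint := integrable_eval_boundedContinuousFunction hf hm hf0
  refine LipschitzWith.of_dist_le_mul fun w z => ?_
  refine (BoundedContinuousFunction.dist_le (by positivity)).2 fun t => ?_
  let v (w : ℝ →ᵇ E) : ℝ →ᵇ E := expWeight T c • w
  let W := expWeight T c
  have hpoint (r : ℝ) : ‖f r (v w r) - f r (v z r)‖ ≤ K * dist w z * W r := by
    refine ((hf r).norm_sub_le _ _).trans ?_
    change K * ‖W r • w r - W r • z r‖ ≤ _
    rw [← smul_sub, norm_smul, Real.norm_of_nonneg (expWeight_nonneg T _ _), ← dist_eq_norm,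
      mul_assoc, mul_comm (dist w z)]
    have := BoundedContinuousFunction.dist_coe_le_dist (f := w) (g := z) r
    gcongr
    exact expWeight_nonneg T _ _
  have happly (w : ℝ →ᵇ E) : weightedVolterra T c f w t =
      expWeight T (-c) t • ∫ r in Iic t, f r (v w r) ∂volume.restrict (Icc 0 T) :=
    congrArg _ (volterra_apply (coeFn_nemytskii_toLp (hint (v w))) t)
  have hW : Integrable W (volume.restrict (Icc 0 T)) := W.integrable _
  rw [dist_eq_norm, happly, happly, ← smul_sub, norm_smul,
    ← integral_sub (hint _).integrableOn (hint _).integrableOn,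
    Real.norm_of_nonneg (expWeight_nonneg T _ _)]
  calc expWeight T (-c) t *
        ‖∫ r in Iic t, (f r (v w r) - f r (v z r)) ∂volume.restrict (Icc 0 T)‖
    _ ≤ expWeight T (-c) t * (K * dist w z * (W t / c)) := by
      gcongr
      · exact expWeight_nonneg T _ _
      · refine (norm_integral_le_of_norm_le (hW.const_mul _).integrableOn
          (ae_of_all _ hpoint)).trans ?_
        rw [integral_const_mul]
        gcongr
        exact integral_Iic_expWeight_le T t hc
    _ = expWeight T c t * expWeight T (-c) t * (K / c * dist w z) := by ring
    _ = _ := by rw [expWeight_mul_expWeight_neg, one_mul, NNReal.coe_div]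

lemma expWeight_smul_eq_add_weightedVolterra {T : ℝ} (c : ℝ) {f : ℝ → E → E} {x : E} {y : ℝ →ᵇ E}
    (hint : Integrable (fun r => f r (y r)) (volume.restrict (Icc 0 T)))
    (hy : ∀ t, y t = x + ∫ r in Iic t, f r (y r) ∂volume.restrict (Icc 0 T)) :
    expWeight T (-c) • y = expWeight T (-c) • BoundedContinuousFunction.const ℝ x +
      weightedVolterra T c f (expWeight T (-c) • y) := by
  rw [weightedVolterra, expWeight_smul_expWeight_neg_smul]
  ext t
  refine (congrArg (expWeight T (-c) t • ·) (hy t)).trans ((smul_add _ _ _).trans ?_)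
  rw [← volterra_apply (coeFn_nemytskii_toLp hint)]
  rfl

variable [FiniteDimensional ℝ E] {θ : Type*} {T : ℝ} {k : ℕ} {f : θ → ℝ → E → E}
  (hf : IsCbFamily 1 (k + 1) fun p : θ × ℝ => f p.1 p.2)
  (hm : ∀ i x, AEStronglyMeasurable (fun r => f i r x) (volume.restrict (Icc 0 T)))
  {C₀ : ℝ} (hf0 : ∀ i r, ‖f i r 0‖ ≤ C₀)

include hf hm hf0

lemma isCbFamily_weightedVolterra (c : ℝ) :
    IsCbFamily 1 (k + 1) fun i => weightedVolterra T c (f i) := by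
  let ν : Measure ℝ := volume.restrict (Icc 0 T)
  let inner : (ℝ →ᵇ E) →L[ℝ] Lp E ∞ ν := (BoundedContinuousFunction.toLp ∞ ν ℝ).comp
    (ContinuousLinearMap.lsmul ℝ (ℝ →ᵇ ℝ) (expWeight T c))
  let outer : Lp E 1 ν →L[ℝ] ℝ →ᵇ E :=
    (ContinuousLinearMap.lsmul ℝ (ℝ →ᵇ ℝ) (expWeight T (-c))).comp (volterra ν)
  exact ((isCbFamily_one_nemytskii hf hm hf0).comp_clm inner).clm_comp
    (A := fun _ => outer) fun _ => le_rfl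

theorem exists_flow : ∃ Y : θ → ℝ → E → E, IsCbFamily 1 (k + 1) (fun p : θ × ℝ => Y p.1 p.2) ∧
    ∀ i x (y : ℝ → E), Integrable (fun r => f i r (y r)) (volume.restrict (Icc 0 T)) →
      (∀ t, y t = x + ∫ r in Iic t, f i r (y r) ∂volume.restrict (Icc 0 T)) →
        ∀ t, y t = Y i t x := by
  obtain ⟨K, hK⟩ := hf.exists_lipschitzWith
  let c : ℝ≥0 := K + 1
  obtain ⟨R, hR, hfix⟩ := (isCbFamily_weightedVolterra hf hm hf0 c).exists_resolvent
    ((div_lt_one (by positivity)).2 (lt_add_one K)) fun i =>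
      lipschitzWith_weightedVolterra (by positivity) (fun r => hK (i, r)) (hm i) (hf0 i)
  let W (c : ℝ) : (ℝ →ᵇ E) →L[ℝ] ℝ →ᵇ E := ContinuousLinearMap.lsmul ℝ (ℝ →ᵇ ℝ) (expWeight T c)
  let const : E →L[ℝ] ℝ →ᵇ E := LinearMap.mkContinuous
    ⟨⟨BoundedContinuousFunction.const ℝ, fun _ _ => rfl⟩, fun _ _ => rfl⟩ 1
    fun x => (BoundedContinuousFunction.norm_const_le x).trans_eq (one_mul ‖x‖).symm
  refine ⟨fun i t x => W c (R i (W (-c) (const x))) t, ?_, fun i x y hy hyt t => ?_⟩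
  · let A (p : θ × ℝ) : (ℝ →ᵇ E) →L[ℝ] E := (BoundedContinuousFunction.evalCLM ℝ p.2).comp (W c)
    exact ((hR.comp_clm ((W (-c)).comp const)).reindex Prod.fst).clm_comp (A := A) fun p =>
      (ContinuousLinearMap.opNorm_comp_le _ _).trans <| mul_le_of_le_one_left (norm_nonneg _) <|
        ContinuousLinearMap.opNorm_le_bound _ zero_le_one fun w =>
          (w.norm_coe_le_norm _).trans_eq (one_mul _).symm
  · let Y : ℝ →ᵇ E := const x + volterra _ (hy.toL1 _)
    have hYy : ⇑Y = y := funext fun t =>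
      (congrArg (x + ·) (volterra_apply hy.coeFn_toL1 t)).trans (hyt t).symm
    have hfixed := (hfix i _ _).1 <| expWeight_smul_eq_add_weightedVolterra (y := Y) c
      (by rwa [hYy]) (by rwa [hYy])
    change y t = (expWeight T c • R i (expWeight T (-c) • BoundedContinuousFunction.const ℝ x)) t
    rw [← hfixed, expWeight_smul_expWeight_neg_smul, hYy]

end Flow

namespace IsCadlagOn

variable {E : Type*} [NormedAddCommGroup E] {s T : ℝ} {f : ℝ → E}

lemma isBounded_image (hf : IsCadlagOn f (Icc s T)) : Bornology.IsBounded (f '' Icc s T) := by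
  refine isCompact_Icc.induction_on (p := fun S => Bornology.IsBounded (f '' S)) (by simp)
    (fun S S' h hS' => hS'.subset (image_mono h)) (fun S S' hS hS' => ?_) fun x hx => ?_
  · rw [image_union]
    exact hS.union hS'
  · obtain ⟨hright, l, hleft⟩ := hf x hx
    obtain ⟨U, hU, hfU⟩ := Metric.exists_isBounded_image_of_tendsto hright
    obtain ⟨V, hV, hfV⟩ := Metric.exists_isBounded_image_of_tendsto hleft
    refine ⟨insert x (U ∪ V), ?_, ?_⟩
    · have hsub : Icc s T ⊆ insert x ((Icc s T ∩ Ioi x) ∪ (Icc s T ∩ Iio x)) := fun r hr => by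
        rcases lt_trichotomy r x with h | h | h
        exacts [.inr (.inr ⟨hr, h⟩), .inl h, .inr (.inl ⟨hr, h⟩)]
      refine nhdsWithin_mono x hsub (insert_mem_nhdsWithin_insert ?_)
      rw [nhdsWithin_union]
      exact union_mem_sup hU hV
    · rw [image_insert_eq, image_union]
      exact (hfU.union hfV).insert _

lemma aestronglyMeasurable (hf : IsCadlagOn f (Icc s T)) :
    AEStronglyMeasurable f (volume.restrict (Icc s T)) := by
  -- `q n r` is a point of a grid strictly to the right of `r`, so that right-continuity applies.
  let q (n : ℕ) (r : ℝ) : ℝ := s + (⌊(r - s) * n⌋₊ + 1) / n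
  have hqm (n : ℕ) : StronglyMeasurable fun r => f (q n r) :=
    (StronglyMeasurable.of_discrete (f := fun m : ℕ => f (s + (m + 1) / n))).comp_measurable
      (g := fun r => ⌊(r - s) * n⌋₊) (by fun_prop)
  rw [← Measure.restrict_congr_set Ico_ae_eq_Icc]
  refine aestronglyMeasurable_of_tendsto_ae atTop (fun n => (hqm n).aestronglyMeasurable) ?_
  filter_upwards [ae_restrict_mem measurableSet_Ico] with r hr
  have hq : Tendsto (fun n => q n r) atTop (𝓝 r) := by
    have hfloor := (tendsto_nat_floor_mul_div_atTop (R := ℝ) (sub_nonneg.2 hr.1)).comp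
      tendsto_natCast_atTop_atTop
    simpa [q, add_div] using (hfloor.add tendsto_one_div_atTop_nhds_zero_nat).const_add s
  have hlt : ∀ᶠ n in atTop, r < q n r := by
    filter_upwards [eventually_gt_atTop 0] with n hn
    have : r - s < (⌊(r - s) * n⌋₊ + 1) / n :=
      (lt_div_iff₀ (by exact_mod_cast hn)).2 (Nat.lt_floor_add_one _)
    exact sub_lt_iff_lt_add'.1 this
  refine (hf r (Ico_subset_Icc_self hr)).1.tendsto.comp (tendsto_nhdsWithin_iff.2 ⟨hq, ?_⟩)
  filter_upwards [hlt, hq.eventually_lt_const hr.2] with n hrq hqT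
  exact ⟨⟨hr.1.trans hrq.le, hqT.le⟩, hrq⟩

lemma integrableOn (hf : IsCadlagOn f (Icc s T)) : IntegrableOn f (Icc s T) := by
  obtain ⟨C, hC⟩ := hf.isBounded_image.exists_norm_le
  exact IntegrableOn.of_bound (by simp) hf.aestronglyMeasurable C <|
    (ae_restrict_mem measurableSet_Icc).mono fun r hr => hC _ (mem_image_of_mem f hr)

end IsCadlagOn

section DifferenceFlow

universe u

variable {E : Type u} [NormedAddCommGroup E]

/-- The vector field `y ↦ b(r, ξ + y) - b(r, ξ)` on `(s, T]`, satisfied by the difference between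
a solution of `dη = b(r, η) dr + dz` and the solution `ξ`. It is set to zero at all other times, and
if `ξ` is not measurable. -/
noncomputable def differenceField (b : ℝ → E → E) (s T : ℝ) (ξ : ℝ → E) : ℝ → E → E :=
  {r | AEStronglyMeasurable ξ (volume.restrict (Ioc s T)) ∧ r ∈ Ioc s T}.indicator
    fun r y => b r (ξ r + y) - b r (ξ r)

lemma differenceField_zero (b : ℝ → E → E) (s T : ℝ) (ξ : ℝ → E) (r : ℝ) :
    differenceField b s T ξ r 0 = 0 := by
  unfold differenceField indicator
  split_ifs <;> simp

variable {b : ℝ → E → E} {T : ℝ}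

lemma aestronglyMeasurable_differenceField (hb : ∀ r ∈ Icc 0 T, Continuous (b r))
    (hbm : ∀ x, AEStronglyMeasurable (fun r => b r x) (volume.restrict (Icc 0 T)))
    {s : ℝ} (hs : 0 ≤ s) (ξ : ℝ → E) (y : E) :
    AEStronglyMeasurable (fun r => differenceField b s T ξ r y) (volume.restrict (Icc 0 T)) := by
  have hsub : Ioc s T ⊆ Icc 0 T := fun r hr => ⟨hs.trans hr.1.le, hr.2⟩
  by_cases hξ : AEStronglyMeasurable ξ (volume.restrict (Ioc s T))
  · have heval {η : ℝ → E} := aestronglyMeasurable_eval (y := η)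
      ((ae_restrict_mem measurableSet_Ioc).mono fun r hr => hb r (hsub hr))
      fun x => (hbm x).mono_measure (Measure.restrict_mono_set _ hsub)
    have hind : (fun r => differenceField b s T ξ r y) =
        (Ioc s T).indicator fun r => b r (ξ r + y) - b r (ξ r) := by
      funext r
      simp only [differenceField, hξ, true_and, indicator, mem_ofPred_eq]
      split_ifs <;> rfl
    rw [hind, aestronglyMeasurable_indicator_iff measurableSet_Ioc,
      Measure.restrict_restrict_of_subset hsub]
    exact (heval (hξ.add aestronglyMeasurable_const)).sub (heval hξ)
  · simp only [differenceField, hξ, false_and, ofPred_false, indicator_empty]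
    exact aestronglyMeasurable_const

variable [NormedSpace ℝ E] {θ : Type*} {s : θ → ℝ} {ξ : θ → ℝ → E}

lemma isCbFamily_differenceField {k : ℕ} (hb : IsCbFamily 1 k fun r : Icc 0 T => b r)
    (hs : ∀ i, 0 ≤ s i) :
    IsCbFamily 1 k fun p : θ × ℝ => differenceField b (s p.1) T (ξ p.1) p.2 := by
  let S : Set (θ × ℝ) :=
    {p | AEStronglyMeasurable (ξ p.1) (volume.restrict (Ioc (s p.1) T)) ∧ p.2 ∈ Ioc (s p.1) T}
  have hmem (p : S) : p.1.2 ∈ Icc 0 T := ⟨(hs _).trans p.2.2.1.le, p.2.2.2⟩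
  have h : IsCbFamily 1 k fun p : S => fun y => b p.1.2 (ξ p.1.1 p.1.2 + y) +
      -b p.1.2 (ξ p.1.1 p.1.2) :=
    ((hb.reindex fun p : S => ⟨p.1.2, hmem p⟩).comp_const_add _).add (.const k _)
  simp only [← sub_eq_add_neg] at h
  exact h.indicator (u := fun (p : θ × ℝ) y => b p.2 (ξ p.1 p.2 + y) - b p.2 (ξ p.1 p.2))

theorem exists_difference_flow [FiniteDimensional ℝ E] {k : ℕ}
    (hb : IsCbFamily 1 (k + 1) fun r : Icc 0 T => b r)
    (hbm : ∀ x, AEStronglyMeasurable (fun r => b r x) (volume.restrict (Icc 0 T)))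
    (hs : ∀ i, 0 ≤ s i) :
    ∃ Y : θ → ℝ → E → E, IsCbFamily 1 (k + 1) (fun p : θ × ℝ => Y p.1 p.2) ∧
      ∀ i, AEStronglyMeasurable (ξ i) (volume.restrict (Ioc (s i) T)) → ∀ x (η : ℝ → E),
        IntegrableOn (fun r => b r (η r) - b r (ξ i r)) (Ioc (s i) T) →
        (∀ t ∈ Icc (s i) T, η t - ξ i t = x + ∫ r in s i..t, (b r (η r) - b r (ξ i r))) →
        ∀ t ∈ Icc (s i) T, η t = ξ i t + Y i t x := by
  obtain ⟨Y, hY, hflow⟩ := exists_flow (C₀ := 0) (isCbFamily_differenceField (ξ := ξ) hb hs)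
    (fun i => aestronglyMeasurable_differenceField (fun r hr => hb.continuous ⟨r, hr⟩) hbm (hs i)
      (ξ i)) (fun i r => by rw [differenceField_zero, norm_zero])
  refine ⟨Y, hY, fun i hξ x η hη heq t ht => ?_⟩
  let g : ℝ → E := (Ioc (s i) T).indicator fun r => b r (η r) - b r (ξ i r)
  let y (t : ℝ) : E := x + ∫ r in Iic t, g r ∂volume.restrict (Icc 0 T)
  have hg_eq (t : ℝ) (ht : t ∈ Icc (s i) T) :
      ∫ r in Iic t, g r ∂volume.restrict (Icc 0 T) = ∫ r in s i..t, (b r (η r) - b r (ξ i r)) := by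
    have hset : Iic t ∩ Icc 0 T ∩ Ioc (s i) T = Ioc (s i) t := by
      ext r
      have := hs i
      simp only [mem_inter_iff, mem_Iic, mem_Icc, mem_Ioc]
      grind
    rw [Measure.restrict_restrict measurableSet_Iic, setIntegral_indicator measurableSet_Ioc, hset,
      intervalIntegral.integral_of_le ht.1]
  have hy (t : ℝ) (ht : t ∈ Icc (s i) T) : y t = η t - ξ i t := by rw [heq t ht, ← hg_eq t ht]
  have hg (r : ℝ) : differenceField b (s i) T (ξ i) r (y r) = g r := by
    by_cases hr : r ∈ Ioc (s i) T
    · simp only [differenceField, g, indicator, mem_ofPred_eq, hξ, hr, true_and, if_true,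
        hy r (Ioc_subset_Icc_self hr), add_sub_cancel]
    · simp only [differenceField, g, indicator, mem_ofPred_eq, hr, and_false, if_false,
        Pi.zero_apply]
  have hg_int : Integrable g (volume.restrict (Icc 0 T)) :=
    (hη.integrable_indicator measurableSet_Ioc).restrict
  rw [← hflow i x y (by simpa only [hg] using hg_int) (fun t => by simp only [hg, y]) t, hy t ht,
    add_sub_cancel]

end DifferenceFlow

/-! ### Transition operators -/

section Noise

variable {Ω : Type*} [MeasurableSpace Ω] {μ : Measure Ω}

lemma IsNoise.aemeasurable_subordinated {N : ℕ} {α : ℝ} {β : Fin N → ℝ≥0 → Ω → ℝ}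
    {L : ℝ≥0 → Ω → ℝ≥0} (h : IsNoise α β L μ) (t : ℝ≥0) : AEMeasurable (subordinated β L t) μ := by
  refine (WithLp.measurable_toLp 2 _).comp_aemeasurable (aemeasurable_pi_lambda _ fun i => ?_)
  have hβ := aestronglyMeasurable_eval (f := fun ω (r : ℝ) => β i r.toNNReal ω)
    ((h.brownian i).cont.mono fun ω hω => hω.comp continuous_real_toNNReal)
    (fun r => ((h.brownian i).aemeasurable r.toNNReal).aestronglyMeasurable)
    (h.subordinator.levy.measurable t).aestronglyMeasurable
  simpa only [Real.toNNReal_coe] using hβ.aemeasurable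

lemma nullMeasurable_of_augmentedFiltration {E F : Type*} [MeasurableSpace E] [MeasurableSpace F]
    {Z : ℝ≥0 → Ω → E} (hZ : ∀ t, AEMeasurable (Z t) μ) {t : ℝ≥0} {Y : Ω → F}
    (hY : Measurable[augmentedFiltration Z μ t] Y) : NullMeasurable Y μ := by
  have hle : augmentedFiltration Z μ t ≤
      (inferInstance : MeasurableSpace (NullMeasurableSpace Ω μ)) :=
    sup_le (iSup_le fun u => Measurable.comap_le (hZ u).nullMeasurable.measurable')
      (MeasurableSpace.generateFrom_le fun S hS => NullMeasurableSet.of_null hS)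
  exact fun S hS => hle _ (hY hS)

end Noise

section TransitionOperators

variable {E : Type*} [NormedAddCommGroup E] [NormedSpace ℝ E] {n : ℕ} {T : ℝ} {B : ℝ → E → E}

lemma IsCbZero.isCbFamily (hB : IsCbZero n T B) : IsCbFamily 0 n fun r : Icc 0 T => B r where
  contDiff r := hB.contDiff r r.2
  bounded j _ hj := (hB.bounded j hj).imp fun _ hC r => hC r r.2

lemma IsCbZero.aestronglyMeasurable (hB : IsCbZero n T B) (x : E) :
    AEStronglyMeasurable (fun r => B r x) (volume.restrict (Icc 0 T)) :=
  (hB.continuousOn.comp (Continuous.prodMk_left x).continuousOn fun _ hr =>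
    ⟨hr, mem_univ x⟩).aestronglyMeasurable measurableSet_Icc

lemma IsCbZero.integrableOn_drift (hB : IsCbZero n T B) (A : E →L[ℝ] E) {s : ℝ} (hs : 0 ≤ s)
    {η : ℝ → E} (hη : IsCadlagOn η (Icc s T)) :
    IntegrableOn (fun r => A (η r) + B r (η r)) (Icc s T) := by
  have hsub : Icc s T ⊆ Icc 0 T := Icc_subset_Icc_left hs
  obtain ⟨C, -, hC⟩ := hB.isCbFamily.exists_norm_le
  refine (A.integrable_comp hη.integrableOn).add (IntegrableOn.of_bound (by simp) ?_ C ?_)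
  · exact aestronglyMeasurable_eval
      ((ae_restrict_mem measurableSet_Icc).mono fun r hr => (hB.contDiff r (hsub hr)).continuous)
      (fun x => (hB.aestronglyMeasurable x).mono_set hsub) hη.aestronglyMeasurable
  · exact (ae_restrict_mem measurableSet_Icc).mono fun _ hr => hC ⟨_, hsub hr⟩ _

variable {Ω : Type*} [MeasurableSpace Ω] {μ : Measure Ω} {N : ℕ}
  {Z : ℝ≥0 → Ω → EuclideanSpace ℝ (Fin N)} {lam σ : Fin N → ℝ}
  {B : ℝ → EuclideanSpace ℝ (Fin N) → EuclideanSpace ℝ (Fin N)}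
  {X : ℝ → EuclideanSpace ℝ (Fin N) → ℝ → Ω → EuclideanSpace ℝ (Fin N)}

theorem exists_stochastic_flow (hB : IsCbZero (n + 1) T B)
    (hX : ∀ s ∈ Icc 0 T, ∀ x, IsSDESolution μ Z lam σ B T s x (X s x)) :
    ∃ Y : Icc 0 T × Ω → ℝ → EuclideanSpace ℝ (Fin N) → EuclideanSpace ℝ (Fin N),
      IsCbFamily 1 (n + 1) (fun p : (Icc 0 T × Ω) × ℝ => Y p.1 p.2) ∧
      ∀ s : Icc 0 T, ∀ x, ∀ᵐ ω ∂μ, ∀ t ∈ Icc (s : ℝ) T,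
        X s x t ω = X s 0 t ω + Y (s, ω) t x := by
  let A := diagOp fun i => -lam i
  let b (r : ℝ) (x : EuclideanSpace ℝ (Fin N)) := A x + B r x
  have hb : IsCbFamily 1 (n + 1) fun r : Icc 0 T => b r :=
    (IsCbFamily.clm n A).add (hB.isCbFamily.mono zero_le_one le_rfl)
  obtain ⟨Y, hY, hflow⟩ := exists_difference_flow (θ := Icc 0 T × Ω) (s := fun p => p.1)
    (ξ := fun p r => X p.1 0 r p.2) hb
    (fun x => aestronglyMeasurable_const.add (hB.aestronglyMeasurable x)) fun p => p.1.2.1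
  refine ⟨Y, hY, fun s x => ?_⟩
  filter_upwards [(hX s s.2 0).cadlag, (hX s s.2 0).equation, (hX s s.2 x).cadlag,
    (hX s s.2 x).equation] with ω hξ hξ_eq hη hη_eq
  have hξ_int := hB.integrableOn_drift A s.2.1 hξ
  have hη_int := hB.integrableOn_drift A s.2.1 hη
  refine hflow (s, ω) (hξ.aestronglyMeasurable.mono_set Ioc_subset_Icc_self) x (X s x · ω)
    ((hη_int.sub hξ_int).mono_set Ioc_subset_Icc_self) fun t ht => ?_
  have hsub : uIcc (s : ℝ) t ⊆ Icc s T := by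
    rw [uIcc_of_le ht.1]
    exact Icc_subset_Icc_right ht.2
  rw [hη_eq t ht, hξ_eq t ht, intervalIntegral.integral_sub
    (hη_int.mono_set hsub).intervalIntegrable (hξ_int.mono_set hsub).intervalIntegrable]
  simp only [A]
  abel

theorem isCbFamily_transitionOp [IsFiniteMeasure μ] (hZ : ∀ t, AEMeasurable (Z t) μ)
    (hB : IsCbZero (n + 1) T B)
    (hX : ∀ s ∈ Icc 0 T, ∀ x, IsSDESolution μ Z lam σ B T s x (X s x))
    {φ : EuclideanSpace ℝ (Fin N) → ℝ} (hφ : IsCb (n + 1) φ) :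
    IsCbFamily 0 (n + 1) fun p : {p : ℝ × ℝ // p.1 ∈ Icc 0 T ∧ p.2 ∈ Icc p.1 T} =>
      transitionOp μ X p.1.1 p.1.2 φ := by
  obtain ⟨Y, hY, hflow⟩ := exists_stochastic_flow hB hX
  let J := {p : ℝ × ℝ // p.1 ∈ Icc 0 T ∧ p.2 ∈ Icc p.1 T}
  let g (p : J) (ω : Ω) (x : EuclideanSpace ℝ (Fin N)) : ℝ :=
    φ (X p.1.1 0 p.1.2 ω + Y (⟨p.1.1, p.2.1⟩, ω) p.1.2 x)
  have hg_eq (p : J) (x) : (fun ω => φ (X p.1.1 x p.1.2 ω)) =ᵐ[μ] fun ω => g p ω x :=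
    (hflow ⟨p.1.1, p.2.1⟩ x).mono fun ω hω => congrArg φ (hω p.1.2 p.2.2)
  have hg : IsCbFamily 0 (n + 1) fun q : J × Ω => g q.1 q.2 := by
    have hφ' : IsCbFamily 0 (n + 1) fun _ : J × Ω => φ :=
      ⟨fun _ => hφ.contDiff, fun j _ hj => (hφ.bounded j hj).imp fun _ hC _ => hC⟩
    exact hφ'.comp ((IsCbFamily.const (n + 1) fun q : J × Ω => X q.1.1.1 0 q.1.1.2 q.2).add
      (hY.reindex fun q : J × Ω => ((⟨q.1.1.1, q.1.2.1⟩, q.2), q.1.1.2)))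
  have hg_meas (p : J) (x) : AEStronglyMeasurable (fun ω => g p ω x) μ := by
    have hXm : AEMeasurable (X p.1.1 x p.1.2) μ :=
      (nullMeasurable_of_augmentedFiltration hZ
        ((hX p.1.1 p.2.1 x).adapted p.1.2 p.2.2)).aemeasurable
    exact ((hφ.contDiff.continuous.measurable.comp_aemeasurable hXm).congr
      (hg_eq p x)).aestronglyMeasurable
  convert isCbFamily_integral hg hg_meas using 3 with p x
  exact integral_congr_ae (hg_eq p x)

lemma norm_partialDeriv_le {h : ℕ} (j : Fin h → Fin N) (f : EuclideanSpace ℝ (Fin N) → ℝ)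
    (x : EuclideanSpace ℝ (Fin N)) : ‖partialDeriv j f x‖ ≤ ‖iteratedFDeriv ℝ h f x‖ := by
  refine (ContinuousMultilinearMap.le_opNorm _ _).trans ?_
  simp

lemma supNorm_le {E : Type*} {f : E → ℝ} {C : ℝ} (h : ∀ x, ‖f x‖ ≤ C) :
    supNorm f ≤ ENNReal.ofReal C :=
  iSup_le fun x => by
    rw [← ofReal_norm]
    exact ENNReal.ofReal_le_ofReal (h x)

lemma IsCbFamily.exists_cbNorm_le {θ : Type*} {u : θ → EuclideanSpace ℝ (Fin N) → ℝ}
    (h : IsCbFamily 0 n u) : ∃ C < ⊤, ∀ i, cbNorm n (u i) ≤ C := by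
  obtain ⟨C, -, hC⟩ := h.exists_bound
  refine ⟨ENNReal.ofReal C + ∑ _i ∈ Finset.Icc 1 n, ENNReal.ofReal C,
    ENNReal.add_lt_top.2 ⟨ENNReal.ofReal_lt_top, ENNReal.sum_lt_top.2 fun _ _ =>
      ENNReal.ofReal_lt_top⟩, fun i => add_le_add (supNorm_le fun x => ?_)
      (Finset.sum_le_sum fun j hj => iSup_le fun l => supNorm_le fun x => ?_)⟩
  · simpa using hC 0 le_rfl (Nat.zero_le _) i x
  · exact (norm_partialDeriv_le _ _ _).trans
      (hC j (Nat.zero_le _) (Finset.mem_Icc.1 hj).2 i x)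

end TransitionOperators

theorem corollary3p3_general {Ω : Type*} [MeasurableSpace Ω] (μ : Measure Ω) [IsFiniteMeasure μ]
    {N : ℕ} (Z : ℝ≥0 → Ω → EuclideanSpace ℝ (Fin N)) (hZ : ∀ t, AEMeasurable (Z t) μ)
    (lam σ : Fin N → ℝ) (T : ℝ) (n : ℕ) (hn : 1 ≤ n)
    (B₀ : ℝ → EuclideanSpace ℝ (Fin N) → EuclideanSpace ℝ (Fin N)) (hB₀ : IsCbZero n T B₀)
    (X : ℝ → EuclideanSpace ℝ (Fin N) → ℝ → Ω → EuclideanSpace ℝ (Fin N))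
    (hX : ∀ s ∈ Icc 0 T, ∀ x, IsSDESolution μ Z lam σ B₀ T s x (X s x))
    (φ : EuclideanSpace ℝ (Fin N) → ℝ) (hφ : IsCb n φ) :
    (∀ s t : ℝ, 0 ≤ s → s ≤ t → t ≤ T → IsCb n (transitionOp μ X s t φ)) ∧
      (⨆ s ∈ Icc 0 T, ⨆ t ∈ Icc s T, cbNorm n (transitionOp μ X s t φ)) < ⊤ := by
  obtain ⟨m, rfl⟩ := Nat.exists_eq_add_of_le' hn
  have h := isCbFamily_transitionOp hZ hB₀ hX hφ
  refine ⟨fun s t hs hst ht => ?_, ?_⟩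
  · let p : {p : ℝ × ℝ // p.1 ∈ Icc 0 T ∧ p.2 ∈ Icc p.1 T} :=
      ⟨(s, t), ⟨hs, hst.trans ht⟩, hst, ht⟩
    exact ⟨h.contDiff p, fun i hi => (h.bounded i (Nat.zero_le _) hi).imp fun _ hC => hC p⟩
  · obtain ⟨C, hC, hle⟩ := h.exists_cbNorm_le
    exact (iSup₂_le fun s hs => iSup₂_le fun t ht => hle ⟨(s, t), hs, ht⟩).trans_lt hC

theorem corollary3p3 {Ω : Type*} [MeasurableSpace Ω] (μ : Measure Ω) [IsProbabilityMeasure μ]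
    [μ.IsComplete] {N : ℕ} (α : ℝ) (hα : α ∈ Ioo (0 : ℝ) 1)
    (β : Fin N → ℝ≥0 → Ω → ℝ) (L : ℝ≥0 → Ω → ℝ≥0) (hnoise : IsNoise α β L μ)
    (lam σ : Fin N → ℝ) (hlam : ∀ i, 0 < lam i) (hσ : ∀ i, 0 < σ i)
    (T : ℝ) (hT : 0 < T) (n : ℕ) (hn : 2 ≤ n)
    (B₀ : ℝ → EuclideanSpace ℝ (Fin N) → EuclideanSpace ℝ (Fin N)) (hB₀ : IsCbZero n T B₀)
    (X : ℝ → EuclideanSpace ℝ (Fin N) → ℝ → Ω → EuclideanSpace ℝ (Fin N))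
    (hX : ∀ s ∈ Icc 0 T, ∀ x, IsSDESolution μ (subordinated β L) lam σ B₀ T s x (X s x))
    (φ : EuclideanSpace ℝ (Fin N) → ℝ) (hφ : IsCb n φ) :
    (∀ s t : ℝ, 0 ≤ s → s ≤ t → t ≤ T → IsCb n (transitionOp μ X s t φ)) ∧
      (⨆ s ∈ Icc 0 T, ⨆ t ∈ Icc s T, cbNorm n (transitionOp μ X s t φ)) < ⊤ :=
  corollary3p3_general μ (subordinated β L) hnoise.aemeasurable_subordinated lam σ T n
    (one_le_two.trans hn) B₀ hB₀ X hX φ hφ
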